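/- Let $(M,\omega)$ be a symplectic manifold (possibly with boundary) and let $L\subset (M,\omega)$ be a closed Lagrangian submanifold with inclusion $\iota:L\to M$. A Lagrangian isotopy of $L$ is a smooth family $\psi=\{\psi_t:L\to M\}_{0\le t\le T}$, $T\ge 0$, of Lagrangian embeddings with $\psi_0=\iota$. Its Lagrangian flux $\mathrm{Flux}(\psi)_t\in H^1(L;\mathbb{R})$ is the class whose value on a closed curve in $L$ is the integral of $\omega$ over the surface $(s,x)\mapsto\psi_s(x)$, $0\le s\le t$, traced out by this curve (oriented by the direction of $s$ followed by the direction of the curve). For $\alpha\in H^1(L;\mathbb{R})$ put $$\mathrm{def}_L(\alpha):=\sup T\in[0,+\infty],$$ the supremum being over all $T\ge 0$ for which there is a Lagrangian isotopy $\psi=\{\psi_t\}_{0\le t\le T}$ of $L$ with $\mathrm{Flux}(\psi)_t=-t\alpha$ for all $0\le t\le T$. For a Lagrangian submanifold $L'\subset M$ let $[\omega]_{L'}\in H^2(M,L';\mathbb{R})$ be its relative symplectic area class; $L'$ is called weakly exact if $[\omega]_{L'}=0$. Let $\partial:H^1(L;\mathbb{R})\to H^2(M,L;\mathbb{R})$ be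 the connecting homomorphism of the pair $(M,L)$. Theorem. Assume that no Lagrangian submanifold of $(M,\omega)$ that is Lagrangian isotopic to $L$ is weakly exact. Let $\alpha\in H^1(L;\mathbb{R})$ be such that $$\partial\alpha=\frac1C\,[\omega]_L$$ for some $C>0$. Then $\mathrm{def}_L(\alpha)\le C$. -/

import Mathlib

open Set MeasureTheory
open scoped Manifold ContDiff Topology

noncomputable section

section Forms

variable {E H : Type*} [NormedAddCommGroup E] [NormedSpace ℝ E] [TopologicalSpace H]
  {I : ModelWithCorners ℝ E H} {M : Type*} [TopologicalSpace M] [ChartedSpace H M]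

variable (I M) in
/-- A (not necessarily continuous) field of alternating `m`-forms on the tangent spaces. -/
abbrev FormField (m : ℕ) : Type _ :=
  (x : M) → TangentSpace I x [⋀^Fin m]→L[ℝ] ℝ

/-- The coordinate expression of `η` in the chart around `x₀`: the pull-back of `η` under
the inverse chart, a form on the target of the chart. -/
def FormField.inChart {m : ℕ} (η : FormField I M m) (x₀ : M) : E → E [⋀^Fin m]→L[ℝ] ℝ :=
  fun y ↦ (η ((extChartAt I x₀).symm y)).compContinuousLinearMap
    (mfderivWithin 𝓘(ℝ, E) I (extChartAt I x₀).symm (range I) y)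

/-- Smooth differential forms. -/
def FormField.IsSmooth {m : ℕ} (η : FormField I M m) : Prop :=
  ∀ x₀ : M, ContDiffOn ℝ ∞ (η.inChart x₀) (extChartAt I x₀).target

/-- `dη = 0`, the exterior derivative being computed in charts. -/
def FormField.IsClosed {m : ℕ} (η : FormField I M m) : Prop :=
  ∀ x₀ : M, ∀ y ∈ (extChartAt I x₀).target,
    extDerivWithin (η.inChart x₀) (extChartAt I x₀).target y = 0

/-- The unit cube `[0,1]^k`. -/
abbrev unitCube (k : ℕ) : Set (Fin k → ℝ) := Icc 0 1

/-- The pull-back of a form under a map from the unit cube. -/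
def FormField.pullCube {m k : ℕ} (η : FormField I M m) (F : (Fin k → ℝ) → M) (p : Fin k → ℝ) :
    (Fin k → ℝ) [⋀^Fin m]→L[ℝ] ℝ :=
  (η (F p)).compContinuousLinearMap
    (mfderivWithin 𝓘(ℝ, Fin k → ℝ) I F (unitCube k) p)

/-- The integral of a `k`-form over a map from `[0,1]^k`. -/
def FormField.cubeIntegral {k : ℕ} (η : FormField I M k) (F : (Fin k → ℝ) → M) : ℝ :=
  ∫ p in unitCube k, η.pullCube F p (fun j ↦ Pi.single j 1)

theorem interior_unitCube (k : ℕ) : interior (unitCube k) = pi univ fun _ ↦ Ioo 0 1 := by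
  rw [unitCube, ← pi_univ_Icc, interior_pi_set finite_univ]
  simp

theorem uniqueDiffOn_unitCube (k : ℕ) : UniqueDiffOn ℝ (unitCube k) := by
  apply uniqueDiffOn_convex (convex_Icc _ _)
  rw [interior_unitCube]
  exact ⟨fun _ ↦ 1 / 2, fun _ _ ↦ ⟨by norm_num, by norm_num⟩⟩

theorem uniqueMDiffWithinAt_unitCube {k : ℕ} {p : Fin k → ℝ} (hp : p ∈ unitCube k) :
    UniqueMDiffWithinAt 𝓘(ℝ, Fin k → ℝ) (unitCube k) p :=
  uniqueMDiffWithinAt_iff_uniqueDiffWithinAt.2 (uniqueDiffOn_unitCube k p hp)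

theorem FormField.pullCube_congr {m k : ℕ} (η : FormField I M m) {F G : (Fin k → ℝ) → M}
    (h : EqOn F G (unitCube k)) {p : Fin k → ℝ} (hp : p ∈ unitCube k) :
    η.pullCube F p = η.pullCube G p := by
  unfold pullCube
  have h1 : F p = G p := h hp
  have h2 := mfderivWithin_congr (I := 𝓘(ℝ, Fin k → ℝ)) (I' := I) (f := G) (f₁ := F) h h1
  revert h2
  generalize mfderivWithin 𝓘(ℝ, Fin k → ℝ) I F (unitCube k) p = A
  generalize mfderivWithin 𝓘(ℝ, Fin k → ℝ) I G (unitCube k) p = B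
  intro h2
  ext v
  change (η (F p)) (fun j ↦ A (v j)) = η (G p) (fun j ↦ B (v j))
  have h2' : (A : (Fin k → ℝ) →L[ℝ] E) = B := h2
  have h3 : ∀ x y : M, x = y → ∀ w : Fin m → E, (η x) w = η y w := by rintro x y rfl w; rfl
  have h4 : (fun j ↦ A (v j) : Fin m → E) = fun j ↦ B (v j) := by
    funext j; exact congrArg (fun T : (Fin k → ℝ) →L[ℝ] E ↦ T (v j)) h2'
  exact (h3 _ _ h1 _).trans (congrArg (fun w : Fin m → E ↦ η (G p) w) h4)

theorem FormField.cubeIntegral_congr {k : ℕ} (η : FormField I M k) {F G : (Fin k → ℝ) → M}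
    (h : EqOn F G (unitCube k)) : η.cubeIntegral F = η.cubeIntegral G :=
  setIntegral_congr_fun measurableSet_Icc fun p hp ↦ by
    simp only [η.pullCube_congr h hp]

theorem insertNth_mem_unitCube {k : ℕ} (i : Fin (k + 1)) {t : ℝ} (ht : t ∈ Icc (0 : ℝ) 1)
    {p : Fin k → ℝ} (hp : p ∈ unitCube k) :
    (i.insertNth t p : Fin (k + 1) → ℝ) ∈ unitCube (k + 1) := by
  rw [unitCube, Fin.insertNth_mem_Icc]
  exact ⟨ht, hp⟩

theorem contDiff_insertNth {k : ℕ} (i : Fin (k + 1)) (t : ℝ) :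
    ContDiff ℝ ∞ (fun p : Fin k → ℝ ↦ (i.insertNth t p : Fin (k + 1) → ℝ)) := by
  rw [contDiff_pi]
  intro j
  obtain rfl | ⟨j, rfl⟩ := Fin.eq_self_or_eq_succAbove i j
  · simpa using contDiff_const
  · simpa using contDiff_apply ℝ ℝ j

theorem hasFDerivAt_insertNth {k : ℕ} (i : Fin (k + 1)) (t : ℝ) (p : Fin k → ℝ) (j : Fin k) :
    fderiv ℝ (fun p : Fin k → ℝ ↦ (i.insertNth t p : Fin (k + 1) → ℝ)) p (Pi.single j 1)
      = Pi.single (i.succAbove j) 1 := by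
  have hd := ((contDiff_insertNth i t).differentiable (by simp)) p
  funext l
  have h1 := hasFDerivAt_pi'.1 hd.hasFDerivAt l
  obtain rfl | ⟨l, rfl⟩ := Fin.eq_self_or_eq_succAbove i l
  · simp only [Fin.insertNth_apply_same] at h1
    have := h1.unique (hasFDerivAt_const t p)
    have h2 := congrArg (fun T : (Fin k → ℝ) →L[ℝ] ℝ ↦ T (Pi.single j 1)) this
    simpa [Pi.single_apply, (Fin.succAbove_ne l j).symm] using h2
  · simp only [Fin.insertNth_apply_succAbove] at h1
    have := h1.unique (hasFDerivAt_apply l p)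
    have h2 := congrArg (fun T : (Fin k → ℝ) →L[ℝ] ℝ ↦ T (Pi.single j 1)) this
    simpa [Pi.single_apply] using h2

theorem FormField.pullCube_face {m k : ℕ} (η : FormField I M m) {F : (Fin (k + 1) → ℝ) → M}
    (hF : ContMDiffOn 𝓘(ℝ, Fin (k + 1) → ℝ) I ∞ F (unitCube (k + 1)))
    (i : Fin (k + 1)) {t : ℝ} (ht : t ∈ Icc (0 : ℝ) 1) {p : Fin k → ℝ} (hp : p ∈ unitCube k)
    (v : Fin m → Fin k) :
    η.pullCube (fun q ↦ F (i.insertNth t q)) p (fun j ↦ Pi.single (v j) 1) =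
      η.pullCube F (i.insertNth t p) (fun j ↦ Pi.single (i.succAbove (v j)) 1) := by
  set ins : (Fin k → ℝ) → (Fin (k + 1) → ℝ) := fun q ↦ i.insertNth t q with hins
  have h1 : mfderivWithin 𝓘(ℝ, Fin k → ℝ) I (F ∘ ins) (unitCube k) p =
      (mfderivWithin 𝓘(ℝ, Fin (k + 1) → ℝ) I F (unitCube (k + 1)) (ins p)).comp
        (mfderivWithin 𝓘(ℝ, Fin k → ℝ) 𝓘(ℝ, Fin (k + 1) → ℝ) ins (unitCube k) p) := by
    apply mfderivWithin_comp
    · exact (hF _ (insertNth_mem_unitCube i ht hp)).mdifferentiableWithinAt (by simp)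
    · exact (((contDiff_insertNth i t).differentiable (by simp)) p).mdifferentiableAt.mdifferentiableWithinAt
    · exact fun q hq ↦ insertNth_mem_unitCube i ht hq
    · exact uniqueMDiffWithinAt_unitCube hp
  change η (F (ins p)) (fun j ↦ mfderivWithin 𝓘(ℝ, Fin k → ℝ) I (F ∘ ins) (unitCube k) p
      (Pi.single (v j) 1)) = η (F (ins p)) (fun j ↦
        mfderivWithin 𝓘(ℝ, Fin (k + 1) → ℝ) I F (unitCube (k + 1)) (ins p)
          (Pi.single (i.succAbove (v j)) 1))
  refine congrArg (fun w : Fin m → E ↦ η (F (ins p)) w) ?_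
  funext j
  have h2 := congrArg (fun T : (Fin k → ℝ) →L[ℝ] E ↦ T (Pi.single (v j) 1)) h1
  refine h2.trans ?_
  rw [mfderivWithin_eq_fderivWithin]
  have h3 : fderivWithin ℝ ins (unitCube k) p (Pi.single (v j) 1)
      = Pi.single (i.succAbove (v j)) 1 := by
    rw [(((contDiff_insertNth i t).differentiable (by simp)) p).fderivWithin
      (uniqueDiffOn_unitCube k p hp)]
    exact hasFDerivAt_insertNth i t p (v j)
  exact congrArg (mfderivWithin 𝓘(ℝ, Fin (k + 1) → ℝ) I F (unitCube (k + 1)) (ins p)) h3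

variable [IsManifold I ∞ M]

/-- Local expression of the pull-back of a form under a smooth map from a cube. -/
theorem FormField.pullCube_local {m k : ℕ} (η : FormField I M m) {F : (Fin k → ℝ) → M}
    (hF : ContMDiffOn 𝓘(ℝ, Fin k → ℝ) I ∞ F (unitCube k)) {p₀ : Fin k → ℝ}
    (hp₀ : p₀ ∈ unitCube k) :
    ∃ V : Set (Fin k → ℝ), IsOpen V ∧ p₀ ∈ V ∧
      ContDiffOn ℝ ∞ (extChartAt I (F p₀) ∘ F) (unitCube k ∩ V) ∧
      MapsTo (extChartAt I (F p₀) ∘ F) (unitCube k ∩ V) (extChartAt I (F p₀)).target ∧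
      ∀ p ∈ unitCube k ∩ V, η.pullCube F p =
        (η.inChart (F p₀) ((extChartAt I (F p₀) ∘ F) p)).compContinuousLinearMap
          (fderivWithin ℝ (extChartAt I (F p₀) ∘ F) (unitCube k ∩ V) p) := by
  set x₀ := F p₀ with hx₀
  obtain ⟨V, hVo, hV⟩ := (continuousOn_iff'.1 hF.continuousOn) _ (isOpen_extChartAt_source (I := I) x₀)
  have hV' : ∀ p ∈ unitCube k ∩ V, F p ∈ (extChartAt I x₀).source := fun p hp ↦ by
    have : p ∈ V ∩ unitCube k := ⟨hp.2, hp.1⟩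
    rw [← hV] at this
    exact this.1
  have hp₀V : p₀ ∈ V := by
    have : p₀ ∈ F ⁻¹' (extChartAt I x₀).source ∩ unitCube k := ⟨mem_extChartAt_source x₀, hp₀⟩
    rw [hV] at this
    exact this.1
  have hu : ContDiffOn ℝ ∞ (extChartAt I x₀ ∘ F) (unitCube k ∩ V) := by
    rw [← contMDiffOn_iff_contDiffOn]
    refine ContMDiffOn.comp (contMDiffOn_extChartAt (I := I) (n := ∞) (x := x₀))
      (hF.mono inter_subset_left) ?_
    intro p hp
    have := hV' p hp
    rwa [extChartAt_source] at this
  refine ⟨V, hVo, hp₀V, hu, fun p hp ↦ (extChartAt I x₀).map_source (hV' p hp), ?_⟩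
  intro p hp
  set u := extChartAt I x₀ ∘ F with hudef
  set s := unitCube k ∩ V with hs
  have hUs : UniqueMDiffWithinAt 𝓘(ℝ, Fin k → ℝ) s p :=
    (uniqueMDiffWithinAt_unitCube hp.1).inter (hVo.mem_nhds hp.2)
  have hpt : (extChartAt I x₀).symm (u p) = F p := (extChartAt I x₀).left_inv (hV' p hp)
  -- the chain rule
  have h1 : mfderivWithin 𝓘(ℝ, Fin k → ℝ) I F (unitCube k) p
      = mfderivWithin 𝓘(ℝ, Fin k → ℝ) I F s p := by
    rw [hs, mfderivWithin_inter (hVo.mem_nhds hp.2)]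
  have h2 : mfderivWithin 𝓘(ℝ, Fin k → ℝ) I ((extChartAt I x₀).symm ∘ u) s p
      = (mfderivWithin 𝓘(ℝ, E) I (extChartAt I x₀).symm (range I) (u p)).comp
        (mfderivWithin 𝓘(ℝ, Fin k → ℝ) 𝓘(ℝ, E) u s p) := by
    apply mfderivWithin_comp
    · exact mdifferentiableWithinAt_extChartAt_symm ((extChartAt I x₀).map_source (hV' p hp))
    · exact ((hu p hp).differentiableWithinAt (by simp)).mdifferentiableWithinAt
    · intro q hq
      exact extChartAt_target_subset_range x₀ ((extChartAt I x₀).map_source (hV' q hq))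
    · exact hUs
  have h3 : (mfderivWithin 𝓘(ℝ, Fin k → ℝ) I F s p : (Fin k → ℝ) →L[ℝ] E)
      = mfderivWithin 𝓘(ℝ, Fin k → ℝ) I ((extChartAt I x₀).symm ∘ u) s p :=
    mfderivWithin_congr (fun q hq ↦ ((extChartAt I x₀).left_inv (hV' q hq)).symm) hpt.symm
  have h4 : ∀ x y : M, x = y → ∀ w : Fin m → E, (η x) w = η y w := by rintro x y rfl w; rfl
  ext v
  change (η (F p)) (fun j ↦ mfderivWithin 𝓘(ℝ, Fin k → ℝ) I F (unitCube k) p (v j)) = 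
    η ((extChartAt I x₀).symm (u p)) (fun j ↦ mfderivWithin 𝓘(ℝ, E) I (extChartAt I x₀).symm
      (range I) (u p) (fderivWithin ℝ u s p (v j)))
  refine (h4 _ _ hpt.symm _).trans (congrArg (fun w : Fin m → E ↦ η _ w) ?_)
  funext j
  have h5 := congrArg (fun T : (Fin k → ℝ) →L[ℝ] E ↦ T (v j)) (h3.trans h2)
  rw [mfderivWithin_eq_fderivWithin] at h5
  rw [h1]
  exact h5

theorem FormField.differentiableWithinAt_pullCube {m k : ℕ} {η : FormField I M m}
    (hη : η.IsSmooth) {F : (Fin k → ℝ) → M}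
    (hF : ContMDiffOn 𝓘(ℝ, Fin k → ℝ) I ∞ F (unitCube k)) {p₀ : Fin k → ℝ}
    (hp₀ : p₀ ∈ unitCube k) :
    DifferentiableWithinAt ℝ (η.pullCube F) (unitCube k) p₀ := by
  obtain ⟨V, hVo, hpV, hu, hmaps, heq⟩ := η.pullCube_local hF hp₀
  have hV : V ∈ 𝓝 p₀ := hVo.mem_nhds hpV
  rw [← differentiableWithinAt_inter hV]
  have hUs : UniqueDiffOn ℝ (unitCube k ∩ V) := (uniqueDiffOn_unitCube k).inter hVo
  refine DifferentiableWithinAt.congr ?_ heq (heq _ ⟨hp₀, hpV⟩)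
  apply DifferentiableWithinAt.continuousAlternatingMapCompContinuousLinearMap
  · exact ((hη (F p₀) _ (hmaps ⟨hp₀, hpV⟩)).differentiableWithinAt (by simp)).comp p₀
      ((hu p₀ ⟨hp₀, hpV⟩).differentiableWithinAt (by simp)) hmaps
  · exact ((hu p₀ ⟨hp₀, hpV⟩).fderivWithin_right hUs (m := 1) (by norm_cast) ⟨hp₀, hpV⟩)
      |>.differentiableWithinAt one_ne_zero

theorem FormField.extDeriv_pullCube {m k : ℕ} {η : FormField I M m}
    (hη : η.IsSmooth) (hc : η.IsClosed) {F : (Fin k → ℝ) → M}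
    (hF : ContMDiffOn 𝓘(ℝ, Fin k → ℝ) I ∞ F (unitCube k)) {p₀ : Fin k → ℝ}
    (hp₀ : p₀ ∈ interior (unitCube k)) :
    extDeriv (η.pullCube F) p₀ = 0 := by
  have hp : p₀ ∈ unitCube k := interior_subset hp₀
  obtain ⟨V, hVo, hpV, hu, hmaps, heq⟩ := η.pullCube_local hF hp
  set s := unitCube k ∩ V with hs
  have hsn : s ∈ 𝓝 p₀ := Filter.inter_mem (mem_interior_iff_mem_nhds.1 hp₀) (hVo.mem_nhds hpV)
  have hps : p₀ ∈ s := ⟨hp, hpV⟩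
  have hUs : UniqueDiffOn ℝ s := (uniqueDiffOn_unitCube k).inter hVo
  have h1 : extDeriv (η.pullCube F) p₀ = extDerivWithin (η.pullCube F) s p₀ := by
    rw [extDeriv, extDerivWithin, fderivWithin_of_mem_nhds hsn]
  rw [h1, extDerivWithin_congr heq (heq _ hps),
    extDerivWithin_pullback (r := ∞) (t := (extChartAt I (F p₀)).target)
      ((hη (F p₀) _ (hmaps hps)).differentiableWithinAt (by simp)) (hu _ hps)
      (by rw [minSmoothness_of_isRCLikeNormedField]; norm_cast) hUs
      (subset_closure (mem_interior_iff_mem_nhds.2 hsn)) hps hmaps,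
    hc _ _ (hmaps hps)]
  ext v
  simp

/-- **Stokes' theorem** for a closed form and a smooth singular cube. -/
theorem FormField.stokes_cube {k : ℕ} {η : FormField I M k}
    (hη : η.IsSmooth) (hc : η.IsClosed) {F : (Fin (k + 1) → ℝ) → M}
    (hF : ContMDiffOn 𝓘(ℝ, Fin (k + 1) → ℝ) I ∞ F (unitCube (k + 1))) :
    ∑ i : Fin (k + 1), (-1 : ℝ) ^ (i : ℕ) *
      (η.cubeIntegral (fun q ↦ F (i.insertNth 1 q)) -
        η.cubeIntegral (fun q ↦ F (i.insertNth 0 q))) = 0 := by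
  set e : Fin (k + 1) → Fin (k + 1) → ℝ := fun j ↦ Pi.single j 1 with he
  set f : Fin (k + 1) → (Fin (k + 1) → ℝ) → ℝ := fun i p ↦
    (-1 : ℝ) ^ (i : ℕ) * η.pullCube F p (i.removeNth e) with hf
  have hd : ∀ p ∈ unitCube (k + 1), DifferentiableWithinAt ℝ (η.pullCube F) (unitCube (k + 1)) p :=
    fun p hp ↦ differentiableWithinAt_pullCube hη hF hp
  have hfd : ∀ i, ∀ p ∈ unitCube (k + 1), DifferentiableWithinAt ℝ (f i) (unitCube (k + 1)) p :=
    fun i p hp ↦ ((hd p hp).continuousAlternatingMap_apply_const _).const_mul _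
  have hdiv : ∀ p ∈ interior (unitCube (k + 1)), ∑ i, fderiv ℝ (f i) p (Pi.single i 1) = 0 := by
    intro p hp
    have hpn := mem_interior_iff_mem_nhds.1 hp
    have hdp := (hd p (interior_subset hp)).differentiableAt hpn
    have h1 := extDeriv_apply hdp e
    rw [extDeriv_pullCube hη hc hF hp] at h1
    rw [← h1.symm.trans (by rfl : (0 : (Fin (k + 1) → ℝ) [⋀^Fin (k + 1)]→L[ℝ] ℝ) e = 0)]
    refine Finset.sum_congr rfl fun i _ ↦ ?_
    rw [hf]
    rw [fderiv_const_mul (hdp.continuousAlternatingMap_apply_const _)]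
    simp [he]
  have hae : unitCube (k + 1) =ᵐ[volume] interior (unitCube (k + 1)) := by
    rw [interior_unitCube]
    exact (Measure.univ_pi_Ioo_ae_eq_Icc (f := fun _ ↦ (0 : ℝ)) (g := fun _ ↦ (1 : ℝ))).symm
  have h0 : EqOn (fun p ↦ ∑ i, fderiv ℝ (f i) p (Pi.single i 1)) (fun _ ↦ 0)
      (interior (unitCube (k + 1))) := fun p hp ↦ hdiv p hp
  have key := integral_divergence_of_hasFDerivAt_off_countable' (0 : Fin (k + 1) → ℝ) 1
    zero_le_one f (fun i p ↦ fderiv ℝ (f i) p) ∅ countable_empty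
    (fun i p hp ↦ (hfd i p hp).continuousWithinAt)
    (fun p hp i ↦ by
      have hp' : p ∈ interior (unitCube (k + 1)) := by
        rw [interior_unitCube]; exact hp.1
      exact ((hfd i p (interior_subset hp')).differentiableAt
        (mem_interior_iff_mem_nhds.1 hp')).hasFDerivAt)
    (by
      refine IntegrableOn.congr_set_ae ?_ hae
      exact (integrableOn_congr_fun h0 isOpen_interior.measurableSet).2 integrableOn_zero)
  rw [setIntegral_congr_set hae, setIntegral_congr_fun isOpen_interior.measurableSet h0] at key
  simp only [integral_zero] at key
  refine Eq.trans ?_ key.symm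
  refine Finset.sum_congr rfl fun i _ ↦ ?_
  have hface : ∀ t ∈ Icc (0 : ℝ) 1, (-1 : ℝ) ^ (i : ℕ) *
      η.cubeIntegral (fun q ↦ F (i.insertNth t q)) =
      ∫ x in Icc ((0 : Fin (k + 1) → ℝ) ∘ i.succAbove) ((1 : Fin (k + 1) → ℝ) ∘ i.succAbove),
        f i (i.insertNth t x) := by
    intro t ht
    have : Icc ((0 : Fin (k + 1) → ℝ) ∘ i.succAbove) ((1 : Fin (k + 1) → ℝ) ∘ i.succAbove) = unitCube k := rfl
    rw [this, cubeIntegral, ← integral_const_mul]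
    refine setIntegral_congr_fun measurableSet_Icc fun p hp ↦ ?_
    exact congrArg _ (η.pullCube_face hF i ht hp id)
  rw [mul_sub, hface 1 (by simp), hface 0 (by simp)]
  rfl

end Forms

section Cubes

variable {E H : Type*} [NormedAddCommGroup E] [NormedSpace ℝ E] [TopologicalSpace H]
  {I : ModelWithCorners ℝ E H} {M : Type*} [TopologicalSpace M] [ChartedSpace H M]
  {E' H' : Type*} [NormedAddCommGroup E'] [NormedSpace ℝ E'] [TopologicalSpace H']
  {J : ModelWithCorners ℝ E' H'} {L : Type*} [TopologicalSpace L] [ChartedSpace H' L]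

/-- The nearest-point retraction of `ℝ^k` onto the unit cube. -/
def clampCube {k : ℕ} (p : Fin k → ℝ) : unitCube k :=
  ⟨(p ⊔ 0) ⊓ 1, le_inf le_sup_right zero_le_one, inf_le_right⟩

theorem clampCube_of_mem {k : ℕ} {p : Fin k → ℝ} (hp : p ∈ unitCube k) :
    clampCube p = ⟨p, hp⟩ :=
  Subtype.ext (by simp [clampCube, sup_eq_left.2 hp.1, inf_eq_left.2 hp.2])

@[simp] theorem clampCube_coe {k : ℕ} (p : unitCube k) : clampCube (p : Fin k → ℝ) = p :=
  clampCube_of_mem p.2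

variable (I M) in
/-- Smooth singular `k`-cubes `[0,1]^k → M`. (The map is extended to all of `ℝ^k` by
composing with the retraction onto the cube; only its values on the cube matter, since
smoothness is smoothness on the closed cube.) -/
@[ext]
structure SmoothCube (k : ℕ) where
  toFun : unitCube k → M
  smooth : ContMDiffOn 𝓘(ℝ, Fin k → ℝ) I ∞ (fun p ↦ toFun (clampCube p)) (unitCube k)

namespace SmoothCube

/-- The map underlying a smooth cube, extended to `ℝ^k`. -/
def extend {k : ℕ} (σ : SmoothCube I M k) (p : Fin k → ℝ) : M := σ.toFun (clampCube p)

/-- The smooth cube given by restricting a map to the unit cube. -/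
def ofMap {k : ℕ} (F : (Fin k → ℝ) → M)
    (hF : ContMDiffOn 𝓘(ℝ, Fin k → ℝ) I ∞ F (unitCube k)) : SmoothCube I M k where
  toFun p := F p
  smooth := hF.congr fun p hp ↦ by rw [clampCube_of_mem hp]

theorem extend_ofMap {k : ℕ} (F : (Fin k → ℝ) → M)
    (hF : ContMDiffOn 𝓘(ℝ, Fin k → ℝ) I ∞ F (unitCube k)) :
    EqOn (ofMap (I := I) F hF).extend F (unitCube k) := fun p hp ↦ by
  simp [extend, ofMap, clampCube_of_mem hp]

/-- The slice `{x_i = t}` of a cube, `0 ≤ t ≤ 1`; it is a face for `t = 0, 1`. -/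
def slice {k : ℕ} (σ : SmoothCube I M (k + 1)) (i : Fin (k + 1)) (t : Icc (0 : ℝ) 1) :
    SmoothCube I M k where
  toFun p := σ.toFun ⟨i.insertNth (t : ℝ) (p : Fin k → ℝ), insertNth_mem_unitCube i t.2 p.2⟩
  smooth := by
    have h : ContMDiffOn 𝓘(ℝ, Fin k → ℝ) I ∞
        (σ.extend ∘ fun p : Fin k → ℝ ↦ (i.insertNth (t : ℝ) p : Fin (k + 1) → ℝ))
        (unitCube k) :=
      σ.smooth.comp (contDiff_insertNth i t).contMDiff.contMDiffOn
        fun p hp ↦ insertNth_mem_unitCube i t.2 hp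
    refine h.congr fun p hp ↦ ?_
    simp [extend, clampCube_of_mem hp, clampCube_of_mem (insertNth_mem_unitCube i t.2 hp)]

theorem extend_slice {k : ℕ} (σ : SmoothCube I M (k + 1)) (i : Fin (k + 1)) (t : Icc (0 : ℝ) 1) :
    EqOn (σ.slice i t).extend (fun p ↦ σ.extend (i.insertNth (t : ℝ) p)) (unitCube k) :=
  fun p hp ↦ by
    simp [extend, slice, clampCube_of_mem hp, clampCube_of_mem (insertNth_mem_unitCube i t.2 hp)]

theorem slice_slice {k : ℕ} (σ : SmoothCube I M (k + 2)) (i : Fin (k + 2)) (j : Fin (k + 1))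
    (s t : Icc (0 : ℝ) 1) :
    (σ.slice (i.succAbove j) t).slice (j.predAbove i) s = (σ.slice i s).slice j t := by
  ext p
  simp only [slice]
  congr 2
  funext l
  obtain rfl | ⟨l, rfl⟩ := Fin.eq_self_or_eq_succAbove i l
  · refine (congrArg ((l.succAbove j).insertNth (t : ℝ) ((j.predAbove l).insertNth (s : ℝ)
      (p : Fin k → ℝ) : Fin (k + 1) → ℝ) : Fin (k + 2) → ℝ)
      (Fin.succAbove_succAbove_predAbove l j).symm).trans ?_
    simp only [Fin.insertNth_apply_succAbove, Fin.insertNth_apply_same]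
  · obtain rfl | ⟨l, rfl⟩ := Fin.eq_self_or_eq_succAbove j l
    · simp only [Fin.insertNth_apply_succAbove, Fin.insertNth_apply_same]
    · refine (congrArg ((i.succAbove j).insertNth (t : ℝ) ((j.predAbove i).insertNth (s : ℝ)
        (p : Fin k → ℝ) : Fin (k + 1) → ℝ) : Fin (k + 2) → ℝ)
        (Fin.succAbove_succAbove_succAbove_predAbove i j l).symm).trans ?_
      simp only [Fin.insertNth_apply_succAbove]

/-- The push-forward of a cube under a smooth map. -/
def map {k : ℕ} (f : C^∞⟮J, L; I, M⟯) (τ : SmoothCube J L k) : SmoothCube I M k where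
  toFun p := f (τ.toFun p)
  smooth := f.contMDiff.comp_contMDiffOn τ.smooth

theorem map_slice {k : ℕ} (f : C^∞⟮J, L; I, M⟯) (τ : SmoothCube J L (k + 1)) (i : Fin (k + 1))
    (t : Icc (0 : ℝ) 1) : (τ.slice i t).map f = (τ.map f).slice i t := rfl

theorem map_injective {k : ℕ} {f : C^∞⟮J, L; I, M⟯} (hf : Function.Injective f) :
    Function.Injective (map (k := k) f) := fun _ _ h ↦
  SmoothCube.ext (funext fun p ↦ hf (congrArg (fun ρ : SmoothCube I M k ↦ ρ.toFun p) h))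

/-- A cube is degenerate if it does not depend on one of its coordinates. -/
def IsDegenerate {k : ℕ} (σ : SmoothCube I M k) : Prop :=
  ∃ i : Fin k, ∀ p q : unitCube k,
    (∀ j, j ≠ i → (p : Fin k → ℝ) j = (q : Fin k → ℝ) j) → σ.toFun p = σ.toFun q

end SmoothCube

variable (I M) in
/-- The real cochains of the normalised smooth cubical singular complex: functions on smooth
cubes that vanish on degenerate cubes, that is, homomorphisms to `ℝ` from the free abelian
group on the smooth cubes modulo the degenerate ones. -/
def Cochain (k : ℕ) : Submodule ℝ (SmoothCube I M k → ℝ) where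
  carrier := {c | ∀ σ, σ.IsDegenerate → c σ = 0}
  zero_mem' := fun _ _ ↦ rfl
  add_mem' := fun ha hb σ hσ ↦ by simp [ha σ hσ, hb σ hσ]
  smul_mem' := fun r a ha σ hσ ↦ by simp [ha σ hσ]

variable (I M) in
/-- The cubical coboundary
`(d c)(σ) = ∑ i, (-1)^i (c (σ|_{x_i = 1}) - c (σ|_{x_i = 0}))` on all functions on cubes. -/
def cubeCoboundary (k : ℕ) :
    (SmoothCube I M k → ℝ) →ₗ[ℝ] (SmoothCube I M (k + 1) → ℝ) where
  toFun c σ := ∑ i : Fin (k + 1), (-1 : ℝ) ^ (i : ℕ) * (c (σ.slice i 1) - c (σ.slice i 0))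
  map_add' a b := by
    funext σ
    simp only [Pi.add_apply, ← Finset.sum_add_distrib]
    exact Finset.sum_congr rfl fun i _ ↦ by ring
  map_smul' r a := by
    funext σ
    simp only [Pi.smul_apply, smul_eq_mul, RingHom.id_apply, Finset.mul_sum]
    exact Finset.sum_congr rfl fun i _ ↦ by ring

theorem cubeCoboundary_mem {k : ℕ} {c : SmoothCube I M k → ℝ} (hc : c ∈ Cochain I M k) :
    cubeCoboundary I M k c ∈ Cochain I M (k + 1) := by
  rintro σ ⟨i₀, h⟩
  change ∑ i : Fin (k + 1), (-1 : ℝ) ^ (i : ℕ) * (c (σ.slice i 1) - c (σ.slice i 0)) = 0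
  refine Finset.sum_eq_zero fun i _ ↦ ?_
  obtain rfl | ⟨j, hj⟩ := Fin.eq_self_or_eq_succAbove i i₀
  · have : σ.slice i₀ 1 = σ.slice i₀ 0 := by
      ext p
      refine h _ _ fun j hj ↦ ?_
      obtain ⟨j, rfl⟩ := Fin.exists_succAbove_eq hj
      simp
    simp [this]
  · have hdeg : ∀ t, (σ.slice i t).IsDegenerate := fun t ↦ by
      refine ⟨j, fun p q hpq ↦ h _ _ fun l hl ↦ ?_⟩
      obtain rfl | ⟨l, rfl⟩ := Fin.eq_self_or_eq_succAbove i l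
      · simp
      · have : l ≠ j := by rintro rfl; exact hl hj.symm
        simpa using hpq l this
    simp [hc _ (hdeg 1), hc _ (hdeg 0)]

theorem cubeCoboundary_cubeCoboundary {k : ℕ} (c : SmoothCube I M k → ℝ) :
    cubeCoboundary I M (k + 1) (cubeCoboundary I M k c) = 0 := by
  funext σ
  have key : ∀ g : Fin (k + 2) × Fin (k + 1) → ℝ,
      (∀ i j, g (i.succAbove j, j.predAbove i) = -g (i, j)) → ∑ x, g x = 0 := by
    intro g hg
    refine Finset.sum_involution (fun x _ ↦ (x.1.succAbove x.2, x.2.predAbove x.1))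
      (fun x _ ↦ by rw [hg]; ring) (fun x _ _ h ↦ ?_) (fun _ _ ↦ Finset.mem_univ _)
      (fun x _ ↦ ?_)
    · exact Fin.succAbove_ne x.1 x.2 (congrArg Prod.fst h)
    · simp [Fin.succAbove_succAbove_predAbove, Fin.predAbove_predAbove_succAbove]
  have := key (fun x ↦ (-1 : ℝ) ^ (x.1 + x.2 : ℕ) *
    ((c ((σ.slice x.1 1).slice x.2 1) - c ((σ.slice x.1 1).slice x.2 0)) -
      (c ((σ.slice x.1 0).slice x.2 1) - c ((σ.slice x.1 0).slice x.2 0)))) (by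
    intro i j
    simp only [SmoothCube.slice_slice, Fin.neg_one_pow_succAbove_add_predAbove]
    ring)
  rw [Fintype.sum_prod_type] at this
  refine Eq.trans ?_ this
  change ∑ i : Fin (k + 2), _ = _
  refine Finset.sum_congr rfl fun i _ ↦ ?_
  change (-1 : ℝ) ^ (i : ℕ) * ((∑ j : Fin (k + 1), _) - ∑ j : Fin (k + 1), _) = _
  rw [← Finset.sum_sub_distrib, Finset.mul_sum]
  refine Finset.sum_congr rfl fun j _ ↦ ?_
  rw [pow_add]
  ring

variable (J L) in
/-- The 1-cocycles. -/
def cocycles1 : Submodule ℝ (SmoothCube J L 1 → ℝ) :=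
  Cochain J L 1 ⊓ LinearMap.ker (cubeCoboundary J L 1)

variable (J L) in
/-- The 1-coboundaries. -/
def coboundaries1 : Submodule ℝ (SmoothCube J L 1 → ℝ) :=
  (Cochain J L 0).map (cubeCoboundary J L 0)

variable (J L) in
/-- The first cohomology `H¹(L; ℝ)`: cocycles modulo coboundaries. -/
abbrev H1 : Type _ := cocycles1 J L ⧸ (coboundaries1 J L).submoduleOf (cocycles1 J L)

/-- The relative cochains of the pair given by an injective map `f : L → M`: cochains on `M`
that vanish on the cubes in `L`. -/
def RelCochain (f : C^∞⟮J, L; I, M⟯) (k : ℕ) : Submodule ℝ (SmoothCube I M k → ℝ) where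
  carrier := {c | c ∈ Cochain I M k ∧ ∀ τ : SmoothCube J L k, c (τ.map f) = 0}
  zero_mem' := ⟨zero_mem _, fun _ ↦ rfl⟩
  add_mem' := fun ha hb ↦ ⟨add_mem ha.1 hb.1, fun τ ↦ by simp [ha.2 τ, hb.2 τ]⟩
  smul_mem' := fun r a ha ↦ ⟨Submodule.smul_mem _ r ha.1, fun τ ↦ by simp [ha.2 τ]⟩

/-- The relative 2-cocycles. -/
def relCocycles2 (f : C^∞⟮J, L; I, M⟯) : Submodule ℝ (SmoothCube I M 2 → ℝ) :=
  RelCochain f 2 ⊓ LinearMap.ker (cubeCoboundary I M 2)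

/-- The relative 2-coboundaries. -/
def relCoboundaries2 (f : C^∞⟮J, L; I, M⟯) : Submodule ℝ (SmoothCube I M 2 → ℝ) :=
  (RelCochain f 1).map (cubeCoboundary I M 1)

/-- The second relative cohomology `H²(M, L; ℝ)` of the pair given by an injective smooth map
`f : L → M`: relative cocycles modulo relative coboundaries. -/
abbrev RelH2 (f : C^∞⟮J, L; I, M⟯) : Type _ :=
  relCocycles2 f ⧸ (relCoboundaries2 f).submoduleOf (relCocycles2 f)

/-- Extension of a cochain on `L` to a cochain on `M`, by zero on all cubes not in `L`. -/
def extendCochain (f : C^∞⟮J, L; I, M⟯) {k : ℕ} (a : SmoothCube J L k → ℝ) :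
    SmoothCube I M k → ℝ :=
  Function.extend (SmoothCube.map f) a 0

theorem extendCochain_mem {f : C^∞⟮J, L; I, M⟯} (hf : Function.Injective f) {k : ℕ}
    {a : SmoothCube J L k → ℝ} (ha : a ∈ Cochain J L k) :
    extendCochain f a ∈ Cochain I M k := by
  rintro σ ⟨i, hi⟩
  by_cases h : ∃ τ : SmoothCube J L k, τ.map f = σ
  · obtain ⟨τ, rfl⟩ := h
    rw [extendCochain, (SmoothCube.map_injective hf).extend_apply]
    exact ha τ ⟨i, fun p q hpq ↦ hf (hi p q hpq)⟩
  · rw [extendCochain, Function.extend_apply' _ _ _ h]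
    rfl

theorem extendCochain_map {f : C^∞⟮J, L; I, M⟯} (hf : Function.Injective f) {k : ℕ}
    (a : SmoothCube J L k → ℝ) (τ : SmoothCube J L k) :
    extendCochain f a (τ.map f) = a τ :=
  (SmoothCube.map_injective hf).extend_apply _ _ _

theorem cubeCoboundary_map (f : C^∞⟮J, L; I, M⟯) {k : ℕ} {c : SmoothCube I M k → ℝ}
    {a : SmoothCube J L k → ℝ} (h : ∀ τ, c (τ.map f) = a τ) (τ : SmoothCube J L (k + 1)) :
    cubeCoboundary I M k c (τ.map f) = cubeCoboundary J L k a τ := by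
  change ∑ i : Fin (k + 1), (-1 : ℝ) ^ (i : ℕ) *
    (c ((τ.slice i 1).map f) - c ((τ.slice i 0).map f)) =
    ∑ i : Fin (k + 1), (-1 : ℝ) ^ (i : ℕ) * (a (τ.slice i 1) - a (τ.slice i 0))
  simp only [h]

/-- The connecting homomorphism on cocycles: extend to `M` and take the coboundary. -/
def connectingCocycle {f : C^∞⟮J, L; I, M⟯} (hf : Function.Injective f) :
    cocycles1 J L →ₗ[ℝ] relCocycles2 f where
  toFun a := ⟨cubeCoboundary I M 1 (extendCochain f a.1), by
    refine ⟨⟨cubeCoboundary_mem (extendCochain_mem hf a.2.1), fun τ ↦ ?_⟩,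
      cubeCoboundary_cubeCoboundary _⟩
    rw [cubeCoboundary_map f (extendCochain_map hf a.1)]
    exact congrFun (LinearMap.mem_ker.1 a.2.2) τ⟩
  map_add' a b := by
    refine Subtype.ext ?_
    change cubeCoboundary I M 1 (extendCochain f (a.1 + b.1)) =
      cubeCoboundary I M 1 (extendCochain f a.1) + cubeCoboundary I M 1 (extendCochain f b.1)
    rw [← map_add, extendCochain, extendCochain, extendCochain, ← Function.extend_add, add_zero]
  map_smul' r a := by
    refine Subtype.ext ?_
    change cubeCoboundary I M 1 (extendCochain f (r • a.1)) =
      r • cubeCoboundary I M 1 (extendCochain f a.1)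
    rw [← map_smul, extendCochain, extendCochain, ← Function.extend_smul, smul_zero]

/-- The connecting homomorphism `∂ : H¹(L; ℝ) → H²(M, L; ℝ)` of the pair. -/
def connecting {f : C^∞⟮J, L; I, M⟯} (hf : Function.Injective f) : H1 J L →ₗ[ℝ] RelH2 f :=
  Submodule.mapQ _ _ (connectingCocycle hf) (by
    rintro ⟨a, ha⟩ ⟨g, hg, hga⟩
    change cubeCoboundary J L 0 g = a at hga
    subst hga
    refine ⟨extendCochain f (cubeCoboundary J L 0 g) -
      cubeCoboundary I M 0 (extendCochain f g), ⟨sub_mem (extendCochain_mem hf ha.1)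
        (cubeCoboundary_mem (extendCochain_mem hf hg)), fun τ ↦ ?_⟩, ?_⟩
    · rw [Pi.sub_apply, extendCochain_map hf, cubeCoboundary_map f (extendCochain_map hf g),
        sub_self]
    · rw [map_sub]
      change _ - cubeCoboundary I M 1 (cubeCoboundary I M 0 (extendCochain f g)) =
        cubeCoboundary I M 1 (extendCochain f (cubeCoboundary J L 0 g))
      rw [cubeCoboundary_cubeCoboundary, sub_zero])

/-- Integration of a `k`-form over smooth cubes, as a cochain. -/
def FormField.toCochain {k : ℕ} (η : FormField I M k) : SmoothCube I M k → ℝ :=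
  fun σ ↦ η.cubeIntegral σ.extend

theorem FormField.toCochain_mem {k : ℕ} (η : FormField I M k) : η.toCochain ∈ Cochain I M k := by
  rintro σ ⟨i, hi⟩
  set P : (Fin k → ℝ) →L[ℝ] (Fin k → ℝ) :=
    ContinuousLinearMap.pi fun j ↦ if j = i then 0 else ContinuousLinearMap.proj j with hP
  have hPa : ∀ p j, P p j = if j = i then 0 else p j := fun p j ↦ by
    by_cases h : j = i <;> simp [hP, h]
  have hPm : ∀ p ∈ unitCube k, P p ∈ unitCube k := fun p hp ↦ by
    constructor <;> intro j <;> rw [hPa] <;> split_ifs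
    exacts [le_rfl, hp.1 j, zero_le_one, hp.2 j]
  have hEq : EqOn σ.extend (σ.extend ∘ P) (unitCube k) := fun p hp ↦ by
    simp only [SmoothCube.extend, Function.comp, clampCube_of_mem hp,
      clampCube_of_mem (hPm p hp)]
    refine hi _ _ fun j hj ↦ ?_
    simp [hPa, hj]
  have h0 : EqOn (fun p ↦ η.pullCube σ.extend p (fun j ↦ Pi.single j 1)) (fun _ ↦ (0 : ℝ))
      (unitCube k) := fun p hp ↦ by
    change η.pullCube σ.extend p (fun j ↦ Pi.single j 1) = 0
    rw [η.pullCube_congr hEq hp, FormField.pullCube]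
    have hc : mfderivWithin 𝓘(ℝ, Fin k → ℝ) I (σ.extend ∘ P) (unitCube k) p =
        (mfderivWithin 𝓘(ℝ, Fin k → ℝ) I σ.extend (unitCube k) (P p)).comp
          (mfderivWithin 𝓘(ℝ, Fin k → ℝ) 𝓘(ℝ, Fin k → ℝ) P (unitCube k) p) := by
      apply mfderivWithin_comp
      · exact (σ.smooth _ (hPm p hp)).mdifferentiableWithinAt (by simp)
      · exact P.differentiableAt.mdifferentiableAt.mdifferentiableWithinAt
      · exact hPm
      · exact uniqueMDiffWithinAt_unitCube hp
    have h1 : fderivWithin ℝ P (unitCube k) p (Pi.single i 1) = 0 := by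
      rw [P.fderivWithin (uniqueDiffOn_unitCube k p hp)]
      funext j
      rw [hPa]
      by_cases h : j = i <;> simp [h]
    refine (η (σ.extend (P p))).map_coord_zero i ?_
    change mfderivWithin 𝓘(ℝ, Fin k → ℝ) I (σ.extend ∘ P) (unitCube k) p (Pi.single i 1) = 0
    rw [hc, mfderivWithin_eq_fderivWithin]
    change mfderivWithin 𝓘(ℝ, Fin k → ℝ) I σ.extend (unitCube k) (P p)
      (fderivWithin ℝ P (unitCube k) p (Pi.single i 1)) = 0
    rw [h1]
    exact map_zero _
  change η.cubeIntegral σ.extend = 0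
  rw [FormField.cubeIntegral, setIntegral_congr_fun measurableSet_Icc h0]
  simp

theorem FormField.cubeCoboundary_toCochain [IsManifold I ∞ M] {k : ℕ} {η : FormField I M k}
    (hη : η.IsSmooth) (hc : η.IsClosed) : cubeCoboundary I M k η.toCochain = 0 := by
  funext σ
  refine Eq.trans ?_ (FormField.stokes_cube hη hc σ.smooth)
  change ∑ i : Fin (k + 1), (-1 : ℝ) ^ (i : ℕ) *
    (η.cubeIntegral (σ.slice i 1).extend - η.cubeIntegral (σ.slice i 0).extend) = _
  refine Finset.sum_congr rfl fun i _ ↦ ?_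
  have := fun t ↦ η.cubeIntegral_congr (σ.extend_slice i t)
  rw [this, this]
  rfl

end Cubes

section Symplectic

variable {E H : Type*} [NormedAddCommGroup E] [NormedSpace ℝ E] [TopologicalSpace H]
  {I : ModelWithCorners ℝ E H} {M : Type*} [TopologicalSpace M] [ChartedSpace H M]
  {E' H' : Type*} [NormedAddCommGroup E'] [NormedSpace ℝ E'] [TopologicalSpace H']
  {J : ModelWithCorners ℝ E' H'} {L : Type*} [TopologicalSpace L] [ChartedSpace H' L]

variable (I M) in
/-- Symplectic forms on `M`: smooth closed nondegenerate 2-forms. -/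
structure SymplecticForm where
  form : FormField I M 2
  smooth : form.IsSmooth
  closed : form.IsClosed
  nondegenerate : ∀ (x : M) (v : TangentSpace I x),
    (∀ w : TangentSpace I x, form x ![v, w] = 0) → v = 0

variable (J L) in
/-- Lagrangian embeddings of `L` into `(M, Ω)`: smooth embeddings (injective differential,
homeomorphism onto the image) of half the dimension that pull `Ω` back to zero. -/
structure LagrangianEmbedding (Ω : SymplecticForm I M) where
  toMap : C^∞⟮J, L; I, M⟯
  injective_mfderiv : ∀ x, Function.Injective (mfderiv J I toMap x)
  isEmbedding : Topology.IsEmbedding toMap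
  finrank_eq : Module.finrank ℝ E = 2 * Module.finrank ℝ E'
  isotropic : ∀ x : L, (Ω.form (toMap x)).compContinuousLinearMap (mfderiv J I toMap x) = 0

theorem FormField.toCochain_map_eq_zero [IsManifold J ∞ L] {k : ℕ} (η : FormField I M k)
    (f : C^∞⟮J, L; I, M⟯)
    (hf : ∀ x, (η (f x)).compContinuousLinearMap (mfderiv J I f x) = 0)
    (τ : SmoothCube J L k) : η.toCochain (τ.map f) = 0 := by
  have h0 : EqOn (fun p ↦ η.pullCube (τ.map f).extend p (fun j ↦ Pi.single j 1))
      (fun _ ↦ (0 : ℝ)) (unitCube k) := fun p hp ↦ by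
    have hc : mfderivWithin 𝓘(ℝ, Fin k → ℝ) I (f ∘ τ.extend) (unitCube k) p =
        (mfderiv J I f (τ.extend p)).comp
          (mfderivWithin 𝓘(ℝ, Fin k → ℝ) J τ.extend (unitCube k) p) := by
      apply mfderiv_comp_mfderivWithin
      · exact f.contMDiff.mdifferentiable (by simp) _
      · exact (τ.smooth _ hp).mdifferentiableWithinAt (by simp)
      · exact uniqueMDiffWithinAt_unitCube hp
    have h1 := congrArg (fun A : E' [⋀^Fin k]→L[ℝ] ℝ ↦ A (fun j ↦
      mfderivWithin 𝓘(ℝ, Fin k → ℝ) J τ.extend (unitCube k) p (Pi.single j 1)))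
      (hf (τ.extend p))
    refine Eq.trans ?_ h1
    refine congrArg (fun w : Fin k → E ↦ η (f (τ.extend p)) w) ?_
    funext j
    exact congrArg (fun T : (Fin k → ℝ) →L[ℝ] E ↦ T (Pi.single j 1)) hc
  rw [FormField.toCochain, FormField.cubeIntegral, setIntegral_congr_fun measurableSet_Icc h0]
  simp

variable {Ω : SymplecticForm I M}

/-- The connecting homomorphism `∂ : H¹(L; ℝ) → H²(M, L; ℝ)` of a Lagrangian submanifold. -/
def LagrangianEmbedding.boundary (e : LagrangianEmbedding J L Ω) : H1 J L →ₗ[ℝ] RelH2 e.toMap :=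
  connecting e.isEmbedding.injective

/-- The relative symplectic area class `[Ω]_L ∈ H²(M, L; ℝ)`: the class of the cocycle that
integrates `Ω` over smooth squares. -/
def LagrangianEmbedding.areaClass [IsManifold I ∞ M] [IsManifold J ∞ L]
    (e : LagrangianEmbedding J L Ω) : RelH2 e.toMap :=
  Submodule.Quotient.mk ⟨Ω.form.toCochain,
    ⟨Ω.form.toCochain_mem, Ω.form.toCochain_map_eq_zero e.toMap e.isotropic⟩,
    FormField.cubeCoboundary_toCochain Ω.smooth Ω.closed⟩

/-- A Lagrangian submanifold is weakly exact if its relative symplectic area class vanishes. -/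
def LagrangianEmbedding.WeaklyExact [IsManifold I ∞ M] [IsManifold J ∞ L]
    (e : LagrangianEmbedding J L Ω) : Prop :=
  e.areaClass = 0

/-- Lagrangian isotopies `ψ_t : L → M`, `0 ≤ t ≤ T`, starting at `e`: families of Lagrangian
embeddings that are smooth as maps `[0,T] × L → M`. -/
structure LagrangianIsotopy (e : LagrangianEmbedding J L Ω) (T : ℝ) where
  nonneg : 0 ≤ T
  stage : Icc (0 : ℝ) T → LagrangianEmbedding J L Ω
  smooth : ContMDiffOn (𝓘(ℝ, ℝ).prod J) I ∞
    (fun p : ℝ × L ↦ (stage (projIcc 0 T nonneg p.1)).toMap p.2) (Icc 0 T ×ˢ univ)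
  stage_zero : stage ⟨0, left_mem_Icc.2 nonneg⟩ = e

namespace LagrangianIsotopy

variable {e : LagrangianEmbedding J L Ω} {T : ℝ}

theorem mul_mem (t : Icc (0 : ℝ) T) {s : ℝ} (hs : s ∈ Icc (0 : ℝ) 1) :
    (t : ℝ) * s ∈ Icc (0 : ℝ) T :=
  ⟨mul_nonneg t.2.1 hs.1, (mul_le_of_le_one_right t.2.1 hs.2).trans t.2.2⟩

theorem tail_mem {k : ℕ} {p : Fin (k + 1) → ℝ} (hp : p ∈ unitCube (k + 1)) :
    (fun j ↦ p (Fin.succ j)) ∈ unitCube k :=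
  ⟨fun j ↦ hp.1 j.succ, fun j ↦ hp.2 j.succ⟩

theorem head_mem {k : ℕ} {p : Fin (k + 1) → ℝ} (hp : p ∈ unitCube (k + 1)) :
    p 0 ∈ Icc (0 : ℝ) 1 :=
  ⟨hp.1 0, hp.2 0⟩

/-- The trace `(s, x) ↦ ψ_{ts}(τ x)`, `0 ≤ s ≤ 1`, of a `k`-cube `τ` in `L` under the
isotopy `(ψ_{t'})_{0 ≤ t' ≤ t}`, as a `(k+1)`-cube in `M`. -/
def trace (ψ : LagrangianIsotopy e T) (t : Icc (0 : ℝ) T) {k : ℕ} (τ : SmoothCube J L k) :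
    SmoothCube I M (k + 1) :=
  SmoothCube.ofMap
    (fun p ↦ (ψ.stage (projIcc 0 T ψ.nonneg (t * p 0))).toMap
      (τ.extend fun j ↦ p (Fin.succ j))) (by
    have h1 : ContMDiffOn 𝓘(ℝ, Fin (k + 1) → ℝ) 𝓘(ℝ, ℝ) ∞
        (fun p : Fin (k + 1) → ℝ ↦ (t : ℝ) * p 0) (unitCube (k + 1)) :=
      (contDiff_const.mul (contDiff_apply ℝ ℝ 0)).contMDiff.contMDiffOn
    have h2 : ContMDiffOn 𝓘(ℝ, Fin (k + 1) → ℝ) J ∞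
        (τ.extend ∘ fun p : Fin (k + 1) → ℝ ↦ fun j : Fin k ↦ p j.succ) (unitCube (k + 1)) :=
      τ.smooth.comp (contDiff_pi.2 fun j : Fin k ↦ contDiff_apply ℝ ℝ j.succ).contMDiff.contMDiffOn
        fun p hp ↦ tail_mem hp
    exact ψ.smooth.comp (h1.prodMk h2) fun p hp ↦ ⟨mul_mem t (head_mem hp), mem_univ _⟩)

theorem trace_toFun (ψ : LagrangianIsotopy e T) (t : Icc (0 : ℝ) T) {k : ℕ}
    (τ : SmoothCube J L k) (p : unitCube (k + 1)) :
    (ψ.trace t τ).toFun p = (ψ.stage ⟨t * (p : Fin (k + 1) → ℝ) 0, mul_mem t (head_mem p.2)⟩).toMap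
      (τ.toFun ⟨fun j ↦ (p : Fin (k + 1) → ℝ) j.succ, tail_mem p.2⟩) := by
  simp [trace, SmoothCube.ofMap, SmoothCube.extend, clampCube_of_mem (tail_mem p.2),
    projIcc_of_mem ψ.nonneg (mul_mem t (head_mem p.2))]

theorem trace_slice_one (ψ : LagrangianIsotopy e T) (t : Icc (0 : ℝ) T) {k : ℕ}
    (τ : SmoothCube J L k) : (ψ.trace t τ).slice 0 1 = τ.map (ψ.stage t).toMap := by
  ext p
  refine (trace_toFun ψ t τ _).trans ?_
  simp [SmoothCube.map]

theorem trace_slice_zero (ψ : LagrangianIsotopy e T) (t : Icc (0 : ℝ) T) {k : ℕ}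
    (τ : SmoothCube J L k) : (ψ.trace t τ).slice 0 0 = τ.map e.toMap := by
  ext p
  refine (trace_toFun ψ t τ _).trans ?_
  simp [SmoothCube.map, ψ.stage_zero]

theorem trace_slice_succ (ψ : LagrangianIsotopy e T) (t : Icc (0 : ℝ) T) {k : ℕ}
    (τ : SmoothCube J L (k + 1)) (i : Fin (k + 1)) (s : Icc (0 : ℝ) 1) :
    (ψ.trace t τ).slice i.succ s = ψ.trace t (τ.slice i s) := by
  ext p
  refine (trace_toFun ψ t τ _).trans (Eq.trans ?_ (trace_toFun ψ t _ p).symm)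
  have h0 : (i.succ.insertNth (s : ℝ) (p : Fin (k + 1) → ℝ) : Fin (k + 2) → ℝ) 0 =
      (p : Fin (k + 1) → ℝ) 0 := by
    have := Fin.insertNth_apply_succAbove (α := fun _ ↦ ℝ) i.succ (s : ℝ)
      (p : Fin (k + 1) → ℝ) 0
    rwa [Fin.succ_succAbove_zero] at this
  have h1 : (fun j : Fin (k + 1) ↦
      (i.succ.insertNth (s : ℝ) (p : Fin (k + 1) → ℝ) : Fin (k + 2) → ℝ) j.succ) =
      (i.insertNth (s : ℝ) (fun j : Fin k ↦ (p : Fin (k + 1) → ℝ) j.succ) :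
        Fin (k + 1) → ℝ) := by
    funext j
    obtain rfl | ⟨j, rfl⟩ := Fin.eq_self_or_eq_succAbove i j
    · simp
    · rw [← Fin.succ_succAbove_succ, Fin.insertNth_apply_succAbove, Fin.insertNth_apply_succAbove]
  simp only [SmoothCube.slice, h0, h1]

theorem trace_isDegenerate (ψ : LagrangianIsotopy e T) (t : Icc (0 : ℝ) T) {k : ℕ}
    {τ : SmoothCube J L k} (h : τ.IsDegenerate) : (ψ.trace t τ).IsDegenerate := by
  obtain ⟨i, hi⟩ := h
  refine ⟨i.succ, fun p q hpq ↦ ?_⟩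
  rw [trace_toFun, trace_toFun]
  have h0 := hpq 0 (Fin.succ_ne_zero i).symm
  have h1 := hi ⟨fun j ↦ (p : Fin (k + 1) → ℝ) j.succ, tail_mem p.2⟩
    ⟨fun j ↦ (q : Fin (k + 1) → ℝ) j.succ, tail_mem q.2⟩
    fun j hj ↦ hpq j.succ fun h ↦ hj (Fin.succ_injective _ h)
  simp only [h0, h1]

/-- The cochain on `L` whose value on a curve is the integral of `Ω` over the surface traced
out by the curve under `(ψ_{t'})_{0 ≤ t' ≤ t}`. -/
def fluxCochain (ψ : LagrangianIsotopy e T) (t : Icc (0 : ℝ) T) : SmoothCube J L 1 → ℝ :=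
  fun γ ↦ Ω.form.toCochain (ψ.trace t γ)

theorem fluxCochain_mem [IsManifold I ∞ M] [IsManifold J ∞ L]
    (ψ : LagrangianIsotopy e T) (t : Icc (0 : ℝ) T) :
    ψ.fluxCochain t ∈ cocycles1 J L := by
  refine ⟨fun γ hγ ↦ Ω.form.toCochain_mem _ (ψ.trace_isDegenerate t hγ),
    LinearMap.mem_ker.2 (funext fun τ ↦ ?_)⟩
  have h := congrFun (FormField.cubeCoboundary_toCochain Ω.smooth Ω.closed) (ψ.trace t τ)
  change ∑ i : Fin 3, (-1 : ℝ) ^ (i : ℕ) * (Ω.form.toCochain ((ψ.trace t τ).slice i 1) -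
    Ω.form.toCochain ((ψ.trace t τ).slice i 0)) = 0 at h
  rw [Fin.sum_univ_succ, trace_slice_one, trace_slice_zero,
    Ω.form.toCochain_map_eq_zero _ (ψ.stage t).isotropic,
    Ω.form.toCochain_map_eq_zero _ e.isotropic] at h
  change ∑ i : Fin 2, (-1 : ℝ) ^ (i : ℕ) * (Ω.form.toCochain (ψ.trace t (τ.slice i 1)) -
    Ω.form.toCochain (ψ.trace t (τ.slice i 0))) = 0
  simp only [trace_slice_succ, Fin.val_succ, pow_succ, Fin.sum_univ_two] at h ⊢
  simp at h ⊢
  linarith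

/-- The Lagrangian flux `Flux(ψ)_t ∈ H¹(L; ℝ)`: the class whose value on a closed curve in `L`
is the integral of `Ω` over the surface traced out by the curve under `(ψ_{t'})_{0 ≤ t' ≤ t}`. -/
def flux [IsManifold I ∞ M] [IsManifold J ∞ L]
    (ψ : LagrangianIsotopy e T) (t : Icc (0 : ℝ) T) : H1 J L :=
  Submodule.Quotient.mk ⟨ψ.fluxCochain t, ψ.fluxCochain_mem t⟩

end LagrangianIsotopy

/-- `e'` is Lagrangian isotopic to `e`. -/
def LagrangianEmbedding.IsIsotopic (e e' : LagrangianEmbedding J L Ω) : Prop :=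
  ∃ (T : ℝ) (ψ : LagrangianIsotopy e T), ψ.stage ⟨T, right_mem_Icc.2 ψ.nonneg⟩ = e'

/-- The deformation invariant `def_L(α) ∈ [0, ∞]`: the supremum of all `T ≥ 0` for which there
is a Lagrangian isotopy `(ψ_t)_{0 ≤ t ≤ T}` of `L` with `Flux(ψ)_t = -t α` for all `t`. -/
def LagrangianEmbedding.deformationInvariant [IsManifold I ∞ M] [IsManifold J ∞ L]
    (e : LagrangianEmbedding J L Ω) (α : H1 J L) : ENNReal :=
  sSup {x | ∃ (T : ℝ) (ψ : LagrangianIsotopy e T),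
    (∀ t : Icc (0 : ℝ) T, ψ.flux t = -((t : ℝ) • α)) ∧ x = ENNReal.ofReal T}

end Symplectic

end

open Set MeasureTheory
open scoped Manifold ContDiff Topology

section Flux

variable {E H : Type*} [NormedAddCommGroup E] [NormedSpace ℝ E] [TopologicalSpace H]
  {I : ModelWithCorners ℝ E H} {M : Type*} [TopologicalSpace M] [ChartedSpace H M]
  {E' H' : Type*} [NormedAddCommGroup E'] [NormedSpace ℝ E'] [TopologicalSpace H']
  {J : ModelWithCorners ℝ E' H'} {L : Type*} [TopologicalSpace L] [ChartedSpace H' L]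

/-! The equation `∂α = (1/C) [Ω]_L` puts the area class in the image of `∂`. Hence its image in the
absolute cohomology of `M` vanishes, and `Ω` has a primitive `c` on `M` whose restriction to `L`
represents `C α`. Write `c_t` for the pull-back of `c` under `ψ_t`. It is a cocycle on `L`, since
the coboundary of `c` is `Ω`, which vanishes on Lagrangian submanifolds.

Evaluating the primitive on the surface swept out by a curve compares its values on the two ends:
`[c_t] = [c_0] + Flux(ψ)_t`. Along an isotopy with `Flux(ψ)_t = -t α` this reads `[c_t] = (C - t)
α`, which vanishes at `t = C`. If the restriction of a primitive of `Ω` to a Lagrangian submanifold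
is a coboundary, the primitive can be corrected so as to vanish there, so the submanifold is weakly
exact. An isotopy that lasts beyond time `C` would therefore pass through a weakly exact Lagrangian,
which is excluded.

The argument runs with singular cochains instead of differential forms: `c` is any function on
smooth curves that vanishes on degenerate ones, and `Ω` enters as the cochain that integrates it.
Cochains on a submanifold extend by zero, with no continuity to respect, so each equation between
classes can be replaced by an equation between representatives. The steps are carried by
`exists_primitive`, `fluxCochain_eq_of_primitive` and `weaklyExact_of_primitive`;
`weaklyExact_stage` combines them. -/

theorem mem_cochain_zero (c : SmoothCube I M 0 → ℝ) : c ∈ Cochain I M 0 :=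
  fun _ ⟨i, _⟩ ↦ i.elim0

variable {Ω : SymplecticForm I M} {e : LagrangianEmbedding J L Ω} {T : ℝ}

/-! ### Isotopies and the variation of a primitive along them -/

namespace LagrangianIsotopy

/-- The restriction of a Lagrangian isotopy to a shorter time interval. -/
def restrict (ψ : LagrangianIsotopy e T) {S : ℝ} (hS : 0 ≤ S) (hST : S ≤ T) :
    LagrangianIsotopy e S where
  nonneg := hS
  stage t := ψ.stage ⟨t, t.2.1, t.2.2.trans hST⟩
  smooth := by
    refine (ψ.smooth.mono (prod_mono (Icc_subset_Icc_right hST) subset_rfl)).congr ?_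
    rintro ⟨t, x⟩ ⟨ht, -⟩
    -- The clampings to `[0,S]` and to `[0,T]` are both the identity on `[0,S]`, so the two families
    -- agree there.
    have ht' : t ∈ Icc 0 T := ⟨ht.1, ht.2.trans hST⟩
    simp only [projIcc_of_mem hS ht, projIcc_of_mem ψ.nonneg ht']
  stage_zero := ψ.stage_zero

/-- Stopping the isotopy at time `t` turns an intermediate stage into an endpoint, which is what
`IsIsotopic` asks for. -/
theorem isIsotopic_stage (ψ : LagrangianIsotopy e T) (t : Icc (0 : ℝ) T) :
    e.IsIsotopic (ψ.stage t) :=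
  ⟨t, ψ.restrict t.2.1 t.2.2, rfl⟩

/-- If `Ω` has the cochain primitive `c`, the flux cochain is the variation of `c` along the
isotopy, up to the coboundary of the cochain that evaluates `c` on traces of points. -/
theorem fluxCochain_eq_of_primitive (ψ : LagrangianIsotopy e T) (t : Icc (0 : ℝ) T)
    {c : SmoothCube I M 1 → ℝ} (hc : cubeCoboundary I M 1 c = Ω.form.toCochain)
    (γ : SmoothCube J L 1) :
    ψ.fluxCochain t γ = c (γ.map (ψ.stage t).toMap) - c (γ.map e.toMap) -
      cubeCoboundary J L 0 (fun x ↦ c (ψ.trace t x)) γ := by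
  -- The swept square has four sides. Those in the time direction `0` are `ψ_t ∘ γ` and `e ∘ γ`;
  -- those in direction `1` are the traces of the endpoints of `γ`, and enter with the opposite
  -- sign.
  have h := congrFun hc (ψ.trace t γ)
  change ∑ i : Fin 2, (-1 : ℝ) ^ (i : ℕ) * (c ((ψ.trace t γ).slice i 1) -
    c ((ψ.trace t γ).slice i 0)) = ψ.fluxCochain t γ at h
  rw [Fin.sum_univ_succ, trace_slice_one, trace_slice_zero] at h
  rw [← h]
  change _ = _ - _ - ∑ i : Fin 1, (-1 : ℝ) ^ (i : ℕ) * (c (ψ.trace t (γ.slice i 1)) -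
    c (ψ.trace t (γ.slice i 0)))
  -- A side in direction `1` is the trace of an endpoint of `γ`, so together these two sides form
  -- the coboundary of `x ↦ c (ψ.trace t x)`.
  simp only [trace_slice_succ, Finset.univ_unique, Finset.sum_singleton, Fin.val_succ]
  simp
  ring

end LagrangianIsotopy

/-! ### Weak exactness through primitives -/

variable [IsManifold I ∞ M] [IsManifold J ∞ L]

/-- A Lagrangian submanifold is weakly exact as soon as `Ω` has a cochain primitive whose
restriction to the submanifold is a coboundary. -/
theorem LagrangianEmbedding.weaklyExact_of_primitive {c : SmoothCube I M 1 → ℝ}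
    (hc : c ∈ Cochain I M 1) (hΩ : cubeCoboundary I M 1 c = Ω.form.toCochain)
    {k : SmoothCube J L 0 → ℝ} (hk : ∀ γ, c (γ.map e.toMap) = cubeCoboundary J L 0 k γ) :
    e.WeaklyExact := by
  -- Subtracting the coboundary of an extension of `k` to `M` kills `c` on the submanifold and
  -- leaves its coboundary unchanged. Any function `k` will do: a 0-cube has no coordinate, so none
  -- is degenerate.
  refine (Submodule.Quotient.mk_eq_zero _).2 ⟨c - cubeCoboundary I M 0 (extendCochain e.toMap k),
    ⟨sub_mem hc (cubeCoboundary_mem (mem_cochain_zero _)), fun γ ↦ ?_⟩, ?_⟩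
  · rw [Pi.sub_apply, cubeCoboundary_map e.toMap
      (extendCochain_map e.isEmbedding.injective k), hk, sub_self]
  · rw [map_sub, cubeCoboundary_cubeCoboundary, sub_zero, hΩ]
    rfl

/-- If `∂[a] = r [Ω]_L` with `r ≠ 0`, then `Ω` has a cochain primitive that restricts to
`r⁻¹ a` on `L`. -/
theorem LagrangianEmbedding.exists_primitive (e : LagrangianEmbedding J L Ω)
    (a : cocycles1 J L) {r : ℝ} (hr : r ≠ 0)
    (h : e.boundary (Submodule.Quotient.mk a) = r • e.areaClass) :
    ∃ c ∈ Cochain I M 1, cubeCoboundary I M 1 c = Ω.form.toCochain ∧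
      ∀ γ, c (γ.map e.toMap) = r⁻¹ * a.1 γ := by
  -- Equality of the two classes yields a relative cochain `b`, zero on `L`, that accounts for the
  -- difference between `∂a` and `r Ω`.
  obtain ⟨b, hb, hbe⟩ := (Submodule.Quotient.eq _).1 h
  change cubeCoboundary I M 1 b = cubeCoboundary I M 1 (extendCochain e.toMap a.1) -
    r • Ω.form.toCochain at hbe
  -- Solving `d b = d ã - r Ω` for `Ω`, where `ã` is the extension of `a` by zero, gives this
  -- primitive; on `L` only `r⁻¹ a` remains, because `b` vanishes there.
  refine ⟨r⁻¹ • (extendCochain e.toMap a.1 - b), Submodule.smul_mem _ _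
    (sub_mem (extendCochain_mem e.isEmbedding.injective a.2.1) hb.1), ?_, fun γ ↦ ?_⟩
  · rw [map_smul, map_sub, hbe, sub_sub_cancel, inv_smul_smul₀ hr]
  · rw [Pi.smul_apply, Pi.sub_apply, extendCochain_map e.isEmbedding.injective, hb.2, sub_zero,
      smul_eq_mul]

/-- If `∂α = r [Ω]_L` with `r ≠ 0`, then a Lagrangian submanifold reached from `L` with flux
`-r⁻¹ α` is weakly exact. -/
theorem LagrangianIsotopy.weaklyExact_stage (ψ : LagrangianIsotopy e T) (t : Icc (0 : ℝ) T)
    {α : H1 J L} {r : ℝ} (hr : r ≠ 0) (hα : e.boundary α = r • e.areaClass)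
    (hflux : ψ.flux t = -(r⁻¹ • α)) : (ψ.stage t).WeaklyExact := by
  obtain ⟨a, rfl⟩ := Submodule.Quotient.mk_surjective _ α
  obtain ⟨c, hc, hΩ, hca⟩ := e.exists_primitive a hr hα
  -- `g` is a 0-cochain whose coboundary is the flux cochain plus `r⁻¹ a`.
  obtain ⟨g, -, hg⟩ := (Submodule.Quotient.eq (y := -(r⁻¹ • a)) _).1 hflux
  change cubeCoboundary J L 0 g = ψ.fluxCochain t - -(r⁻¹ • a.1) at hg
  -- On `ψ_t(L)` the primitive equals its restriction `r⁻¹ a` to `L`, plus the flux cochain `d g -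
  -- r⁻¹ a`, plus the coboundary of its values on traces of points. The terms in `a` cancel, and the
  -- potential `k` collects the other two.
  refine LagrangianEmbedding.weaklyExact_of_primitive hc hΩ
    (k := g + fun x ↦ c (ψ.trace t x)) fun γ ↦ ?_
  have h1 := congrFun hg γ
  have h2 := ψ.fluxCochain_eq_of_primitive t hΩ γ
  rw [hca] at h2
  simp only [Pi.sub_apply, Pi.neg_apply, Pi.smul_apply, smul_eq_mul] at h1
  rw [map_add, Pi.add_apply]
  linarith

end Flux

/-- Let `ι : L → M` be a closed Lagrangian submanifold of a symplectic manifold `(M, Ω)`, possibly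
with boundary, such that no Lagrangian submanifold Lagrangian isotopic to `L` is weakly exact.
If `∂α = (1/C) [Ω]_L` with `C > 0`, then `def_L(α) ≤ C`. -/
theorem mainTheorem4 {E H M L : Type*} {n : ℕ}
    [NormedAddCommGroup E] [NormedSpace ℝ E] [FiniteDimensional ℝ E]
    [TopologicalSpace H] (I : ModelWithCorners ℝ E H)
    [TopologicalSpace M] [T2Space M] [SecondCountableTopology M]
    [ChartedSpace H M] [IsManifold I ∞ M]
    [TopologicalSpace L] [T2Space L] [CompactSpace L]
    [ChartedSpace (EuclideanSpace ℝ (Fin n)) L] [IsManifold (𝓡 n) ∞ L]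
    (Ω : SymplecticForm I M) (ι : LagrangianEmbedding (𝓡 n) L Ω)
    (hno : ∀ e : LagrangianEmbedding (𝓡 n) L Ω, ι.IsIsotopic e → ¬ e.WeaklyExact)
    (α : H1 (𝓡 n) L) (C : ℝ) (hC : 0 < C)
    (hα : ι.boundary α = (1 / C) • ι.areaClass) :
    ι.deformationInvariant α ≤ ENNReal.ofReal C := by
  refine sSup_le ?_
  rintro _ ⟨T, ψ, hψ, rfl⟩
  refine ENNReal.ofReal_le_ofReal (not_lt.1 fun hT ↦ ?_)
  -- With `r = 1/C`, the flux `-r⁻¹ α` is attained exactly at time `C`, which `C < T` makes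
  -- available.
  let t : Icc (0 : ℝ) T := ⟨C, hC.le, hT.le⟩
  refine hno _ (ψ.isIsotopic_stage t)
    (ψ.weaklyExact_stage t (one_div_ne_zero hC.ne') hα ?_)
  rw [hψ t, one_div, inv_inv]
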